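/- Let $G$ be an Abelian group of infinite exponent, i.e. there is no integer $n\ge 1$ with $nG=0$ (so $G$ is infinite), and let $H$ be any countable (finite or countably infinite) torsion subgroup of $G$. Then $G$ admits a complete, non-discrete, Hausdorff group topology $\tau$ whose von Neumann radical $$\mathbf{n}(G,\tau)=\bigcap\{\ker\chi : \chi\colon (G,\tau)\to\mathbb{T}\ \text{a continuous homomorphism}\}$$ is equal to $H$, where $\mathbb{T}=\{z\in\mathbb{C}:|z|=1\}$ is the circle group. -/

import Mathlib

/-- An additive group is unbounded (of infinite exponent) if no positive integer annihilates it. -/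
def IsUnboundedAddGroup (G : Type*) [AddCommGroup G] : Prop :=
  ¬ AddMonoid.ExponentExists G

/-- The von Neumann radical of an Abelian topological group: the intersection of the kernels of
all its continuous characters, i.e. of all continuous homomorphisms to the circle group. -/
noncomputable def vonNeumannRadical (G : Type*) [AddCommGroup G] [TopologicalSpace G] :
    AddSubgroup G :=
  ⨅ χ : {χ : AddChar G Circle // Continuous χ}, χ.1.toAddMonoidHom.ker

/-- The set of all subgroups `H` of `G` for which there is a complete non-discrete Hausdorff group
topology on `G` whose von Neumann radical is `H`. Completeness is with respect to the group
uniformity (the left and right uniformities coincide, as `G` is Abelian). -/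
def NRC (G : Type*) [AddCommGroup G] : Set (AddSubgroup G) :=
  {H | ∃ (_ : TopologicalSpace G) (_ : IsTopologicalAddGroup G),
    T2Space G ∧ ¬ DiscreteTopology G ∧
    @CompleteSpace G (IsTopologicalAddGroup.rightUniformSpace G) ∧
    vonNeumannRadical G = H}

/-! Take a countable unbounded subgroup `K` containing `H`, and let `h` list each element of `H`
infinitely often. For a sequence `x` in `K`, use the finest group topology in which the multiples `c
• x i` with `|c| ≤ 2 ^ i` and the elements `blockSum x n + h n` tend to 0. For a continuous
character, control of the multiples up to `2 ^ i` forces its values at `x i` to approach 1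
geometrically (`charDist_le_pow`), so its values on block sums tend to 1, hence so do those at `h
n`: it is trivial on `H`.

Conversely, for each element of `K` outside `H`, fix a character trivial on `H` but not at that
element. If `x i` is chosen within `4 ^ (-i)` of the kernels of the first `i` of these, all of them
become continuous. Characters trivial on `K` are continuous too, so the radical is exactly `H`.

The topology is always complete, by a diagonal argument over compact sets. It is Hausdorff by the
Protasov–Zelenyuk criterion: each `x i` also avoids the finitely many short relations with earlier
terms, and a bounded number of terms cannot cancel a whole long block. -/

open Filter Topology Set
open scoped Pointwise

/-! ### The finest group topology making a family converge to 0: completeness and separation. -/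

section NullFamily

variable {G : Type*} [AddCommGroup G]

/-- A decreasing sequence of symmetric sets containing `0`, any two of which differ by a finite
set: the tails of a family indexed by a countable set, which will be made to converge to `0`. -/
structure IsNullFamily (A : ℕ → Set G) : Prop where
  antitone : Antitone A
  zero_mem : ∀ k, 0 ∈ A k
  neg_mem : ∀ k, ∀ a ∈ A k, -a ∈ A k
  finite_diff : ∀ k, (A 0 \ A k).Finite

/-- The set of finite sums `a 0 + ⋯ + a (n - 1)` with `a k ∈ A (i k)`. -/
def sumNhd (A : ℕ → Set G) (i : ℕ → ℕ) : Set G :=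
  {g | ∃ (n : ℕ) (a : ℕ → G), (∀ k, a k ∈ A (i k)) ∧ g = ∑ k ∈ Finset.range n, a k}

namespace IsNullFamily

variable {A : ℕ → Set G}

theorem sumNhd_mono (hA : IsNullFamily A) {i j : ℕ → ℕ} (h : ∀ k, i k ≤ j k) :
    sumNhd A j ⊆ sumNhd A i := by
  rintro g ⟨n, a, ha, rfl⟩
  exact ⟨n, a, fun k => hA.antitone (h k) (ha k), rfl⟩

theorem subset_sumNhd (hA : IsNullFamily A) (i : ℕ → ℕ) : A (i 0) ⊆ sumNhd A i := by
  intro g hg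
  refine ⟨1, fun k => if k = 0 then g else 0, fun k => ?_, by simp⟩
  by_cases hk : k = 0
  · simp [hk, hg]
  · simp [hk, hA.zero_mem]

theorem exists_long_sum (hA : IsNullFamily A) {i : ℕ → ℕ} {g : G} (hg : g ∈ sumNhd A i) :
    ∃ n, ∀ m, n ≤ m → ∃ a : ℕ → G, (∀ k, a k ∈ A (i k)) ∧ g = ∑ k ∈ Finset.range m, a k := by
  obtain ⟨n, a, ha, rfl⟩ := hg
  refine ⟨n, fun m hm => ⟨fun k => if k < n then a k else 0, fun k => ?_, ?_⟩⟩
  · by_cases hk : k < n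
    · simp [hk, ha]
    · simp [hk, hA.zero_mem]
  · rw [← Finset.sum_filter]
    congr 1
    ext k
    simp only [Finset.mem_range, Finset.mem_filter]
    omega

/-- Two sums are interleaved, one in the even places and the other in the odd ones. -/
theorem exists_add_subset (hA : IsNullFamily A) (i : ℕ → ℕ) :
    ∃ j, sumNhd A j + sumNhd A j ⊆ sumNhd A i := by
  refine ⟨fun k => max (i (2 * k)) (i (2 * k + 1)), ?_⟩
  rintro _ ⟨g, hg, g', hg', rfl⟩
  obtain ⟨n, hn⟩ := hA.exists_long_sum hg
  obtain ⟨n', hn'⟩ := hA.exists_long_sum hg'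
  obtain ⟨a, ha, rfl⟩ := hn (max n n') (le_max_left _ _)
  obtain ⟨b, hb, rfl⟩ := hn' (max n n') (le_max_right _ _)
  refine ⟨2 * max n n', fun k => if k % 2 = 0 then a (k / 2) else b (k / 2), fun k => ?_, ?_⟩
  · by_cases hk : k % 2 = 0
    · simp only [hk, if_true]
      have h := hA.antitone (le_max_left _ _) (ha (k / 2))
      rwa [show 2 * (k / 2) = k by omega] at h
    · simp only [hk, if_false]
      have h := hA.antitone (le_max_right _ _) (hb (k / 2))
      rwa [show 2 * (k / 2) + 1 = k by omega] at h
  · generalize max n n' = m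
    induction m with
    | zero => simp
    | succ m ih =>
      rw [Finset.sum_range_succ, Finset.sum_range_succ, show 2 * (m + 1) = 2 * m + 1 + 1 by ring,
        Finset.sum_range_succ, Finset.sum_range_succ, ← ih]
      have h1 : (2 * m + 1) % 2 = 1 := by omega
      have h2 : (2 * m + 1) / 2 = m := by omega
      simp [h1, h2]
      abel

/-- The neighbourhood basis at `0` of the finest group topology in which the family converges
to `0`. -/
@[reducible]
def filterBasis (hA : IsNullFamily A) : AddGroupFilterBasis G :=
  addGroupFilterBasisOfComm (range (sumNhd A)) (range_nonempty _)
    (by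
      rintro _ _ ⟨i, rfl⟩ ⟨j, rfl⟩
      exact ⟨_, ⟨fun k => max (i k) (j k), rfl⟩, subset_inter
        (hA.sumNhd_mono fun k => le_max_left _ _) (hA.sumNhd_mono fun k => le_max_right _ _)⟩)
    (by
      rintro _ ⟨i, rfl⟩
      exact ⟨0, 0, fun k => hA.zero_mem _, by simp⟩)
    (by
      rintro _ ⟨i, rfl⟩
      obtain ⟨j, hj⟩ := hA.exists_add_subset i
      exact ⟨_, ⟨j, rfl⟩, hj⟩)
    (by
      rintro _ ⟨i, rfl⟩
      refine ⟨_, ⟨i, rfl⟩, ?_⟩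
      rintro _ ⟨n, a, ha, rfl⟩
      exact ⟨n, -a, fun k => hA.neg_mem _ _ (ha k), by simp⟩)

/-- The finest group topology in which the family converges to `0`. -/
@[reducible]
def topology (hA : IsNullFamily A) : TopologicalSpace G := hA.filterBasis.topology

theorem isTopologicalAddGroup (hA : IsNullFamily A) :
    @IsTopologicalAddGroup G hA.topology _ :=
  hA.filterBasis.isTopologicalAddGroup

theorem mem_nhds_zero (hA : IsNullFamily A) {U : Set G} :
    U ∈ @nhds G hA.topology 0 ↔ ∃ i, sumNhd A i ⊆ U := by
  rw [(AddGroupFilterBasis.nhds_zero_hasBasis hA.filterBasis).mem_iff]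
  constructor
  · rintro ⟨_, ⟨i, rfl⟩, h⟩
    exact ⟨i, h⟩
  · rintro ⟨i, h⟩
    exact ⟨_, ⟨i, rfl⟩, h⟩

theorem exists_subset_of_mem_nhds (hA : IsNullFamily A) {U : Set G}
    (hU : U ∈ @nhds G hA.topology 0) : ∃ k, A k ⊆ U := by
  obtain ⟨i, hi⟩ := hA.mem_nhds_zero.1 hU
  exact ⟨i 0, (hA.subset_sumNhd i).trans hi⟩

/-- An ultrafilter on `A 0` that does not converge to 0 misses some tail, so it contains a finite
set and is principal. -/
theorem isCompact (hA : IsNullFamily A) : @IsCompact G hA.topology (A 0) := by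
  let _ := hA.topology
  rw [isCompact_iff_ultrafilter_le_nhds]
  intro f hf
  by_cases h : (f : Filter G) ≤ 𝓝 0
  · exact ⟨0, hA.zero_mem 0, h⟩
  · obtain ⟨U, hU, hUf⟩ := Filter.not_le.1 h
    obtain ⟨k, hk⟩ := hA.exists_subset_of_mem_nhds hU
    have hc : (A k)ᶜ ∈ f := by
      rw [Ultrafilter.compl_mem_iff_notMem]
      exact fun hk' => hUf (mem_of_superset hk' hk)
    have hd : A 0 \ A k ∈ f := inter_mem (le_principal_iff.1 hf) hc
    obtain ⟨x, hx, rfl⟩ := Ultrafilter.eq_pure_of_finite_mem (hA.finite_diff k) hd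
    exact ⟨x, hx.1, by simpa using pure_le_nhds x⟩

theorem isCompact_nsmul (hA : IsNullFamily A) (n : ℕ) :
    @IsCompact G hA.topology (n • A 0) := by
  let _ := hA.topology
  have := hA.isTopologicalAddGroup
  induction n with
  | zero => simp
  | succ n ih => rw [succ_nsmul]; exact ih.add hA.isCompact

theorem _root_.sum_range_mem_nsmul {a : ℕ → G} (ha : ∀ k, a k ∈ A 0) (n : ℕ) :
    ∑ k ∈ Finset.range n, a k ∈ n • A 0 := by
  induction n with
  | zero => simp
  | succ n ih =>
    rw [Finset.sum_range_succ, succ_nsmul]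
    exact add_mem_add ih (ha n)

theorem sumNhd_subset_nsmul_add (hA : IsNullFamily A) (i : ℕ → ℕ) (n : ℕ) :
    sumNhd A i ⊆ n • A 0 + sumNhd A (fun k => i (n + k)) := by
  intro g hg
  obtain ⟨m, hm⟩ := hA.exists_long_sum hg
  obtain ⟨a, ha, rfl⟩ := hm (n + m) (by omega)
  rw [Finset.sum_range_add]
  exact add_mem_add (sum_range_mem_nsmul (fun k => hA.antitone (Nat.zero_le _) (ha k)) n)
    ⟨m, fun k => a (n + k), fun k => ha _, rfl⟩

/-- A Cauchy filter without limit stays away from a neighbourhood of each compact set `x₀ + n • A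
0`. A single diagonal neighbourhood handles all `n` at once, and a small set of the filter then
meets one of the forbidden neighbourhoods. -/
theorem completeSpace (hA : IsNullFamily A) :
    @CompleteSpace G
      (@IsTopologicalAddGroup.rightUniformSpace G _ hA.topology hA.isTopologicalAddGroup) := by
  let t := hA.topology
  have := hA.isTopologicalAddGroup
  let u := IsTopologicalAddGroup.rightUniformSpace G
  have : IsUniformAddGroup G := isUniformAddGroup_of_addCommGroup
  refine ⟨fun {f} hf => ?_⟩
  by_contra hlim
  have := hf.1
  have hsmall : ∀ i, ∃ s ∈ f, ∀ x ∈ s, ∀ y ∈ s, y - x ∈ sumNhd A i := by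
    intro i
    have h0 : sumNhd A i ∈ 𝓝 (0 : G) := hA.mem_nhds_zero.2 ⟨i, Subset.rfl⟩
    have h1 : (fun p : G × G => p.2 - p.1) ⁻¹' sumNhd A i ∈ uniformity G := by
      rw [uniformity_eq_comap_nhds_zero]
      exact preimage_mem_comap h0
    obtain ⟨s, hs, hss⟩ := (cauchy_iff.1 hf).2 _ h1
    exact ⟨s, hs, fun x hx y hy => hss (mk_mem_prod hx hy)⟩
  have hsep : ∀ K : Set G, IsCompact K →
      ∃ i, ∃ F ∈ f, ∀ x ∈ K, ∀ w ∈ sumNhd A i, x + w ∉ F := by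
    intro K hK
    have hd : Disjoint (𝓝ˢ K) f := by
      rw [hK.disjoint_nhdsSet_left]
      intro x _
      by_contra hx
      exact hlim ⟨x, le_nhds_of_cauchy_adhp hf (neBot_iff.2 fun h => hx (disjoint_iff.2 h))⟩
    obtain ⟨V, ⟨hVo, hKV⟩, F, hF, hVF⟩ := ((hasBasis_nhdsSet K).disjoint_iff f.basis_sets).1 hd
    obtain ⟨U, hU, hKU⟩ := compact_open_separated_add_right hK hVo hKV
    obtain ⟨i, hi⟩ := hA.mem_nhds_zero.1 hU
    exact ⟨i, F, hF, fun x hx w hw hxw =>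
      disjoint_left.1 hVF (hKU (add_mem_add hx (hi hw))) hxw⟩
  obtain ⟨s₀, hs₀, hd₀⟩ := hsmall 0
  obtain ⟨x₀, hx₀⟩ := hf.1.nonempty_of_mem hs₀
  choose i F hF hdis using fun n => hsep ({x₀} + n • A 0)
    (isCompact_singleton.add (hA.isCompact_nsmul n))
  -- Shifted by any `n`, this sequence dominates `i (2 * n)`. The factor 2 is needed because `x -
  -- x₀` and the head `b` of `y - x` each use up `n` summands.
  obtain ⟨s, hs, hd⟩ := hsmall fun t => ∑ n ∈ Finset.range (t + 1), i (2 * n) (t - n)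
  obtain ⟨x, hxs, hx₀s⟩ := hf.1.nonempty_of_mem (inter_mem hs hs₀)
  obtain ⟨n, a, ha, hxa⟩ := hd₀ x₀ hx₀ x hx₀s
  obtain ⟨y, hys, hyF⟩ := hf.1.nonempty_of_mem (inter_mem hs (hF (2 * n)))
  obtain ⟨b, hb, w, hw, hbw⟩ := hA.sumNhd_subset_nsmul_add _ n (hd x hxs y hys)
  have hw' : w ∈ sumNhd A (i (2 * n)) := by
    refine hA.sumNhd_mono (fun k => ?_) hw
    have := Finset.single_le_sum (f := fun m => i (2 * m) (n + k - m)) (fun _ _ => Nat.zero_le _)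
      (show n ∈ Finset.range (n + k + 1) from Finset.mem_range.2 (by omega))
    simpa using this
  have hab : (x - x₀) + b ∈ (2 * n) • A 0 := by
    rw [two_mul, add_nsmul]
    refine add_mem_add ?_ hb
    rw [hxa]
    exact sum_range_mem_nsmul ha n
  refine hdis (2 * n) (x₀ + ((x - x₀) + b)) (add_mem_add rfl hab) w hw' ?_
  have : x₀ + ((x - x₀) + b) + w = y := by
    have : b + w = y - x := hbw
    rw [add_assoc, add_assoc, this]; abel
  rwa [this]

theorem nsmul_mono (hA : IsNullFamily A) (m : ℕ) {j k : ℕ} (h : j ≤ k) : m • A k ⊆ m • A j := by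
  induction m with
  | zero => simp
  | succ m ih => simp only [succ_nsmul]; exact add_subset_add ih (hA.antitone h)

/-- Shows that the closure property `hS` passes from `S` to `S + A j`. Either the summand from `A j`
can be taken in arbitrarily late tails, and `hS` for `m + 1` applies; or it eventually lies in a
finite set `A 0 \ A l`, and a common large `k` rules out each candidate. -/
theorem mem_add_of_forall_mem (hA : IsNullFamily A) {S : Set G}
    (hS : ∀ (m : ℕ) (g : G), (∀ k, g ∈ S + m • A k) → g ∈ S) (j m : ℕ) (g : G)
    (hg : ∀ k, g ∈ S + A j + m • A k) : g ∈ S + A j := by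
  by_cases h : ∀ l, ∃ k, l ≤ k ∧ ∃ s ∈ S, ∃ a ∈ A l, ∃ t ∈ m • A k, s + a + t = g
  · have : g ∈ S := by
      refine hS (m + 1) g fun l => ?_
      obtain ⟨k, hlk, s, hs, a, ha, t, ht, rfl⟩ := h l
      rw [add_assoc, add_comm a t, succ_nsmul]
      exact add_mem_add hs (add_mem_add (hA.nsmul_mono m hlk ht) ha)
    simpa using add_mem_add this (hA.zero_mem j)
  · push Not at h
    obtain ⟨l, hl⟩ := h
    by_contra hgS
    have hT : ∀ a ∈ A 0 \ A l, a ∈ A j → ∀ᶠ k in atTop, g - a ∉ S + m • A k := by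
      intro a _ haj
      have : g - a ∉ S := fun h => hgS (by simpa using add_mem_add h haj)
      obtain ⟨k₀, hk₀⟩ := not_forall.1 (mt (hS m (g - a)) this)
      filter_upwards [eventually_ge_atTop k₀] with k hk hmem
      exact hk₀ (add_subset_add_left (hA.nsmul_mono m hk) hmem)
    obtain ⟨k, hk, hlk⟩ := (((hA.finite_diff l).eventually_all.2
      fun a ha => eventually_imp_distrib_left.2 (hT a ha)).and (eventually_ge_atTop l)).exists
    obtain ⟨_, ⟨s, hs, a, ha, rfl⟩, t, ht, hst⟩ := hg k
    have hst : s + a + t = g := hst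
    have hal : a ∉ A l := fun h => hl k hlk s hs a h t ht hst
    refine hk a ⟨hA.antitone (Nat.zero_le _) ha, hal⟩ ha ?_
    rw [show g - a = s + t by rw [← hst]; abel]
    exact add_mem_add hs ht

/-- The Protasov–Zelenyuk criterion. -/
theorem t2Space (hA : IsNullFamily A) (h : ∀ g : G, g ≠ 0 → ∀ m : ℕ, ∃ k, g ∉ m • A k) :
    @T2Space G hA.topology := by
  let t := hA.topology
  have := hA.isTopologicalAddGroup
  rw [AddGroupFilterBasis.t2Space_iff hA.filterBasis rfl]
  have key : ∀ g : G, g ≠ 0 → ∃ i, g ∉ sumNhd A i := by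
    intro g hg
    -- Starting from `{0}`, tails are added one at a time while preserving `P`; all partial sums
    -- then stay in sets missing `g`.
    let P : Set G → Prop := fun S => (∀ (m : ℕ) (g : G), (∀ k, g ∈ S + m • A k) → g ∈ S) ∧ g ∉ S
    have hstep : ∀ S : {S // P S}, ∃ k, P (S.1 + A k) := by
      rintro ⟨S, hS, hgS⟩
      obtain ⟨k, hk⟩ := not_forall.1 (mt (hS 1 g) hgS)
      exact ⟨k, hA.mem_add_of_forall_mem hS k, by simpa using hk⟩
    choose κ hκ using hstep
    have h0 : P {0} := by
      refine ⟨fun m x hx => ?_, hg⟩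
      by_contra hx0
      obtain ⟨k, hk⟩ := h x hx0 m
      exact hk (by simpa using hx k)
    let st : ℕ → {S // P S} := fun n =>
      Nat.rec ⟨{0}, h0⟩ (fun _ S => ⟨S.1 + A (κ S), hκ S⟩) n
    refine ⟨fun n => κ (st n), ?_⟩
    rintro ⟨n, a, ha, hga⟩
    have hmem : ∀ n, ∑ k ∈ Finset.range n, a k ∈ (st n).1 := by
      intro n
      induction n with
      | zero => simp [st]
      | succ n ih =>
        rw [Finset.sum_range_succ]
        exact add_mem_add ih (ha n)
    exact (st n).2.2 (hga ▸ hmem n)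
  ext g
  simp only [mem_sInter, mem_singleton_iff]
  constructor
  · intro hg
    by_contra hg0
    obtain ⟨i, hi⟩ := key g hg0
    exact hi (hg _ ⟨i, rfl⟩)
  · rintro rfl U hU
    exact hA.filterBasis.zero hU

end IsNullFamily

end NullFamily

/-! ### Characters: estimates, continuity and extension. -/

section Characters

variable {G : Type*} [AddCommGroup G]

/-- The distance from `1` of the value of a character. -/
noncomputable def charDist (χ : AddChar G Circle) (g : G) : ℝ := ‖(χ g : ℂ) - 1‖

theorem charDist_nonneg (χ : AddChar G Circle) (g : G) : 0 ≤ charDist χ g := norm_nonneg _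

theorem charDist_zero (χ : AddChar G Circle) : charDist χ 0 = 0 := by simp [charDist]

theorem charDist_eq_zero {χ : AddChar G Circle} {g : G} : charDist χ g = 0 ↔ χ g = 1 := by
  rw [charDist, norm_eq_zero, sub_eq_zero, Circle.coe_eq_one]

theorem dist_apply_eq_charDist (χ : AddChar G Circle) (g h : G) :
    dist (χ g) (χ h) = charDist χ (g - h) := by
  have h0 : dist (χ g) (χ h) = ‖(χ g : ℂ) - χ h‖ := dist_eq_norm (χ g : ℂ) (χ h : ℂ)
  have h1 : (χ g : ℂ) = χ (g - h) * χ h := by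
    rw [← Circle.coe_mul, ← AddChar.map_add_eq_mul, sub_add_cancel]
  rw [h0, h1, show (χ (g - h) * χ h - χ h : ℂ) = (χ (g - h) - 1) * χ h by ring, norm_mul,
    Circle.norm_coe, mul_one, charDist]

theorem charDist_eq_dist (χ : AddChar G Circle) (g : G) : charDist χ g = dist (χ g) (χ 0) := by
  rw [dist_apply_eq_charDist, sub_zero]

theorem charDist_neg (χ : AddChar G Circle) (g : G) : charDist χ (-g) = charDist χ g := by
  rw [← zero_sub, ← dist_apply_eq_charDist, dist_comm, ← charDist_eq_dist]

theorem charDist_add_le (χ : AddChar G Circle) (g h : G) :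
    charDist χ (g + h) ≤ charDist χ g + charDist χ h := by
  have := dist_triangle (χ (g + h)) (χ h) (χ 0)
  rwa [← charDist_eq_dist, ← charDist_eq_dist, dist_apply_eq_charDist, add_sub_cancel_right] at this

theorem charDist_sum_le {ι : Type*} (χ : AddChar G Circle) (s : Finset ι) (a : ι → G) :
    charDist χ (∑ k ∈ s, a k) ≤ ∑ k ∈ s, charDist χ (a k) :=
  Finset.le_sum_of_subadditive (charDist χ) (charDist_zero χ).le (charDist_add_le χ) s a

theorem charDist_nsmul_le (χ : AddChar G Circle) (n : ℕ) (g : G) :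
    charDist χ (n • g) ≤ n * charDist χ g := by
  induction n with
  | zero => simp [charDist_zero]
  | succ n ih =>
    rw [succ_nsmul]
    refine (charDist_add_le χ _ _).trans ?_
    push_cast
    linarith

theorem charDist_zsmul_le (χ : AddChar G Circle) (k : ℤ) (g : G) :
    charDist χ (k • g) ≤ |(k : ℝ)| * charDist χ g := by
  obtain ⟨n, rfl | rfl⟩ := k.eq_nat_or_neg
  · simpa using charDist_nsmul_le χ n g
  · simpa [charDist_neg] using charDist_nsmul_le χ n g

/-- Since `z ^ 2 - 1 = (z - 1) * (z + 1)`, and `|z + 1| ≥ 3 / 2` when `|z - 1| ≤ 1 / 2`. -/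
theorem charDist_le_of_two_nsmul {χ : AddChar G Circle} {g : G} (h : charDist χ g ≤ 1 / 2) :
    charDist χ g ≤ 2 / 3 * charDist χ (2 • g) := by
  have h1 : (χ (2 • g) : ℂ) - 1 = (χ g - 1) * (2 + (χ g - 1)) := by
    rw [two_nsmul, AddChar.map_add_eq_mul, Circle.coe_mul]; ring
  have h2 : charDist χ (2 • g) = charDist χ g * ‖2 + ((χ g : ℂ) - 1)‖ := by
    rw [charDist, h1, norm_mul, charDist]
  have h3 : 3 / 2 ≤ ‖2 + ((χ g : ℂ) - 1)‖ := by
    have := norm_sub_le_norm_add (2 : ℂ) ((χ g : ℂ) - 1)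
    have h4 : ‖(χ g : ℂ) - 1‖ ≤ 1 / 2 := h
    norm_num at this
    linarith
  rw [h2]
  nlinarith [charDist_nonneg χ g]

/-- A point of the circle whose first `2 ^ j`-th powers stay close to `1` is very close to `1`. -/
theorem charDist_le_pow {χ : AddChar G Circle} {g : G} {n : ℕ}
    (h : ∀ j ≤ n, charDist χ (2 ^ j • g) ≤ 1 / 2) : charDist χ g ≤ (2 / 3) ^ n := by
  have key : ∀ j ≤ n, charDist χ g ≤ (2 / 3) ^ j * charDist χ (2 ^ j • g) := by
    intro j
    induction j with
    | zero => simp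
    | succ j ih =>
      intro hj
      refine (ih (by omega)).trans ?_
      rw [pow_succ (2 / 3 : ℝ), mul_assoc]
      have := charDist_le_of_two_nsmul (h j (by omega))
      rw [smul_smul, ← pow_succ'] at this
      gcongr
  refine (key n le_rfl).trans (mul_le_of_le_one_right (by positivity) ?_)
  linarith [h n le_rfl]

theorem IsNullFamily.exists_charDist_lt {A : ℕ → Set G} (hA : IsNullFamily A)
    {χ : AddChar G Circle} (hχ : @Continuous G Circle hA.topology _ χ) {ε : ℝ} (hε : 0 < ε) :
    ∃ k, ∀ a ∈ A k, charDist χ a < ε := by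
  let _ := hA.topology
  have h : χ ⁻¹' Metric.ball (χ 0) ε ∈ 𝓝 (0 : G) :=
    hχ.continuousAt.preimage_mem_nhds (Metric.ball_mem_nhds _ hε)
  obtain ⟨k, hk⟩ := hA.exists_subset_of_mem_nhds h
  exact ⟨k, fun a ha => by rw [charDist_eq_dist]; exact hk ha⟩

theorem IsNullFamily.continuous_addChar {A : ℕ → Set G} (hA : IsNullFamily A)
    {χ : AddChar G Circle} (hχ : ∀ ε > 0, ∃ k, ∀ a ∈ A k, charDist χ a ≤ ε) :
    @Continuous G Circle hA.topology _ χ := by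
  let _ := hA.topology
  have := hA.isTopologicalAddGroup
  rw [continuous_iff_continuousAt]
  intro x
  rw [ContinuousAt, Metric.tendsto_nhds]
  intro ε hε
  choose i hi using fun n : ℕ => hχ (ε / 4 * (1 / 2) ^ n) (by positivity)
  have h0 : sumNhd A i ∈ 𝓝 (x - x) := by
    rw [sub_self]; exact hA.mem_nhds_zero.2 ⟨i, Subset.rfl⟩
  filter_upwards [(continuous_id.sub continuous_const).continuousAt.preimage_mem_nhds h0] with y hy
  obtain ⟨n, a, ha, hya⟩ := hy
  rw [dist_apply_eq_charDist, show y - x = _ from hya]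
  calc charDist χ (∑ k ∈ Finset.range n, a k)
      ≤ ∑ k ∈ Finset.range n, charDist χ (a k) := charDist_sum_le _ _ _
    _ ≤ ∑ k ∈ Finset.range n, ε / 4 * (1 / 2) ^ k := Finset.sum_le_sum fun k _ => hi k _ (ha k)
    _ = ε / 4 * ∑ k ∈ Finset.range n, (1 / 2 : ℝ) ^ k := by rw [Finset.mul_sum]
    _ ≤ ε / 4 * 2 := by gcongr; exact sum_geometric_two_le n
    _ < ε := by linarith

/-- The inclusion of the torsion of the circle `ℝ / ℤ`. -/
noncomputable def ratAddCircleToReal : AddCircle (1 : ℚ) →+ AddCircle (1 : ℝ) :=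
  QuotientAddGroup.map _ _ (Rat.castHom ℝ).toAddMonoidHom (by
    rw [AddSubgroup.zmultiples_le]
    exact ⟨1, by simp⟩)

theorem ratAddCircleToReal_injective : Function.Injective ratAddCircleToReal := by
  rw [injective_iff_map_eq_zero]
  intro a
  induction a using QuotientAddGroup.induction_on with
  | H q =>
    intro h
    have h1 : (((q : ℚ) : ℝ) : AddCircle (1 : ℝ)) = 0 := h
    rw [AddCircle.coe_eq_zero_iff] at h1 ⊢
    obtain ⟨n, hn⟩ := h1
    refine ⟨n, ?_⟩
    simp only [zsmul_eq_mul, mul_one] at hn ⊢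
    exact_mod_cast hn

/-- Characters of `G ⧸ H` with values in `ℚ / ℤ` separate points, and `ℚ / ℤ` embeds in the circle.
-/
theorem exists_addChar_apply_ne_one (H : AddSubgroup G) {g : G} (hg : g ∉ H) :
    ∃ χ : AddChar G Circle, (∀ h ∈ H, χ h = 1) ∧ χ g ≠ 1 := by
  have hg' : (g : G ⧸ H) ≠ 0 := mt (QuotientAddGroup.eq_zero_iff g).1 hg
  obtain ⟨c, hc⟩ := CharacterModule.exists_character_apply_ne_zero_of_ne_zero hg'
  let ψ : G →+ AddCircle (1 : ℝ) :=
    ratAddCircleToReal.comp (AddMonoidHom.comp c (QuotientAddGroup.mk' H))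
  refine ⟨⟨fun x => (ψ x).toCircle, by simp, fun a b => by simp [AddCircle.toCircle_add]⟩,
    fun h hh => ?_, fun h => ?_⟩
  · have : ψ h = 0 := by
      have h0 : (h : G ⧸ H) = 0 := (QuotientAddGroup.eq_zero_iff h).2 hh
      change ratAddCircleToReal (c (h : G ⧸ H)) = 0
      rw [h0, map_zero, map_zero]
    change (ψ h).toCircle = 1
    rw [this, AddCircle.toCircle_zero]
  · have h1 : (ψ g).toCircle = (0 : AddCircle (1 : ℝ)).toCircle := by
      rw [AddCircle.toCircle_zero]; exact h
    have h2 : ψ g = 0 := AddCircle.injective_toCircle one_ne_zero h1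
    exact hc (ratAddCircleToReal_injective (h2.trans (map_zero _).symm))

theorem mem_vonNeumannRadical [TopologicalSpace G] {g : G} :
    g ∈ vonNeumannRadical G ↔ ∀ χ : AddChar G Circle, Continuous χ → χ g = 1 := by
  simp only [vonNeumannRadical, AddSubgroup.mem_iInf, Subtype.forall]
  rfl

end Characters

/-! ### Choice of the sequence, and the continuous characters of the resulting topology. -/

section Construction

variable {G : Type*} [AddCommGroup G]

theorem exists_countable_unbounded_addSubgroup (hG : IsUnboundedAddGroup G) (H : AddSubgroup G)
    [Countable H] :
    ∃ K : AddSubgroup G, H ≤ K ∧ Countable K ∧ ∀ n : ℕ, 0 < n → ∃ y ∈ K, n • y ≠ 0 := by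
  have h : ∀ n : ℕ, ∃ y : G, 0 < n → n • y ≠ 0 := by
    intro n
    by_contra hn
    push Not at hn
    exact hG ⟨n, (hn 0).1, fun y => (hn y).2⟩
  choose y hy using h
  let w : H ⊕ ℕ → G := Sum.elim Subtype.val y
  have hw : ∀ s, w s ∈ LinearMap.range (Finsupp.linearCombination ℤ w) := fun s =>
    ⟨Finsupp.single s 1, by simp⟩
  refine ⟨(LinearMap.range (Finsupp.linearCombination ℤ w)).toAddSubgroup,
    fun g hg => hw (Sum.inl ⟨g, hg⟩), ?_, fun n hn => ⟨y n, hw (Sum.inr n), hy n hn⟩⟩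
  exact (countable_range (Finsupp.linearCombination ℤ w)).to_subtype

/-- If `M • K` had finite order `N`, then `N * M` would annihilate `K`. -/
theorem infinite_image_nsmul {K : AddSubgroup G}
    (hK : ∀ n : ℕ, 0 < n → ∃ y ∈ K, n • y ≠ 0) {M : ℕ} (hM : 0 < M) :
    ((fun y => M • y) '' (K : Set G)).Infinite := by
  intro hfin
  let L : AddSubgroup G := K.map (nsmulAddMonoidHom M)
  have hL : Finite L := hfin.to_subtype
  obtain ⟨y, hy, hne⟩ := hK (Nat.card L * M) (Nat.mul_pos Nat.card_pos hM)
  have h0 : Nat.card L • (⟨M • y, ⟨y, hy, rfl⟩⟩ : L) = 0 := card_nsmul_eq_zero'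
  have h1 : Nat.card L • M • y = 0 := congrArg Subtype.val h0
  exact hne (by rw [mul_nsmul', h1])

/-- By compactness of the torus, some sequence in `K` with distinct `M`-multiples has convergent
images under the `χ l`; late differences are nearly killed by every `χ l`, and infinitely many of
their `M`-multiples are distinct. -/
theorem exists_charDist_lt_of_infinite {K : AddSubgroup G} {M : ℕ}
    (hK : ((fun y => M • y) '' (K : Set G)).Infinite) {E : Set G} (hE : E.Finite) {n : ℕ}
    (χ : Fin n → AddChar G Circle) {ε : ℝ} (hε : 0 < ε) :
    ∃ x ∈ K, M • x ∉ E ∧ ∀ l, charDist (χ l) x < ε := by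
  have hy : ∀ k, ∃ y ∈ K, M • y = (hK.natEmbedding _ k : G) := fun k =>
    (hK.natEmbedding _ k).2
  choose y hyK hy using hy
  have hinj : Function.Injective fun k => M • y k := by
    intro a b hab
    simp only [hy] at hab
    exact (hK.natEmbedding _).injective (Subtype.ext hab)
  obtain ⟨_, σ, hσ, hlim⟩ := CompactSpace.tendsto_subseq fun k => fun l => χ l (y k)
  obtain ⟨k₀, hk₀⟩ := Metric.cauchySeq_iff'.1 hlim.cauchySeq ε hε
  have hinj' : Function.Injective fun k => M • (y (σ (k₀ + k)) - y (σ k₀)) := by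
    intro a b hab
    simp only [smul_sub, sub_left_inj] at hab
    have := hσ.injective (hinj hab)
    omega
  obtain ⟨_, ⟨k, rfl⟩, hk⟩ := (infinite_range_of_injective hinj').exists_notMem_finite hE
  refine ⟨_, K.sub_mem (hyK _) (hyK _), hk, fun l => ?_⟩
  rw [← dist_apply_eq_charDist]
  exact (dist_le_pi_dist (fun l => χ l (y (σ (k₀ + k)))) (fun l => χ l (y (σ k₀))) l).trans_lt
    (hk₀ _ (by omega))

/-- If `c • x = e` with `0 < |c| ≤ C`, then `C! • x = (C! / c) • e`; so it suffices that the one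
multiple `C! • x` avoids a finite set. -/
theorem exists_zsmul_notMem {K : AddSubgroup G}
    (hK : ∀ n : ℕ, 0 < n → ∃ y ∈ K, n • y ≠ 0) {E : Set G} (hE : E.Finite) (C n : ℕ)
    (χ : Fin n → AddChar G Circle) {ε : ℝ} (hε : 0 < ε) :
    ∃ x ∈ K, (∀ c : ℤ, c ≠ 0 → |c| ≤ C → c • x ∉ E) ∧ ∀ l, charDist (χ l) x < ε := by
  have hE' : (image2 (fun (c : ℤ) e => ((C.factorial : ℤ) / c) • e)
      (Icc (-C : ℤ) C) E).Finite := (finite_Icc _ _).image2 _ hE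
  obtain ⟨x, hx, hxE, hχ⟩ := exists_charDist_lt_of_infinite
    (infinite_image_nsmul hK C.factorial_pos) hE' χ hε
  refine ⟨x, hx, fun c hc hcC hcx => hxE ⟨c, abs_le.1 hcC, c • x, hcx, ?_⟩, hχ⟩
  have hdvd : c ∣ (C.factorial : ℤ) := by
    rw [← Int.natAbs_dvd_natAbs, Int.natAbs_natCast]
    exact Nat.dvd_factorial (Int.natAbs_pos.2 hc) (by rw [Int.abs_eq_natAbs] at hcC; omega)
  simp only
  rw [smul_smul, Int.ediv_mul_cancel hdvd, natCast_zsmul]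

/-- The finite set of elements that the multiples of the `i`-th term have to avoid. -/
def avoidSet (g h : ℕ → G) (C : ℕ → ℕ) (i : ℕ) (x : ℕ → G) : Set G :=
  {e | ∃ l ≤ i, ∃ c μ : ℕ → ℤ, (∀ j, |c j| ≤ C i) ∧ (∀ j, |μ j| ≤ C i) ∧
    e = g l - ∑ j ∈ Finset.range i, c j • x j - ∑ j ∈ Finset.range (i + 1), μ j • h j}

theorem finite_avoidSet (g h : ℕ → G) (C : ℕ → ℕ) (i : ℕ) (x : ℕ → G) :
    (avoidSet g h C i x).Finite := by
  let f : ℕ × (Fin i → ℤ) × (Fin (i + 1) → ℤ) → G := fun p =>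
    g p.1 - ∑ j, p.2.1 j • x j - ∑ j, p.2.2 j • h j
  have hfin : (Iic i ×ˢ (Icc (fun _ => -(C i : ℤ)) (fun _ => (C i : ℤ)) : Set (Fin i → ℤ)) ×ˢ
      (Icc (fun _ => -(C i : ℤ)) (fun _ => (C i : ℤ)) : Set (Fin (i + 1) → ℤ))).Finite :=
    (finite_Iic i).prod ((finite_Icc _ _).prod (finite_Icc _ _))
  refine (hfin.image f).subset ?_
  rintro _ ⟨l, hl, c, μ, hc, hμ, rfl⟩
  refine ⟨(l, fun j => c j, fun j => μ j), ⟨hl, ⟨fun j => (abs_le.1 (hc j)).1,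
    fun j => (abs_le.1 (hc j)).2⟩, ⟨fun j => (abs_le.1 (hμ j)).1, fun j => (abs_le.1 (hμ j)).2⟩⟩, ?_⟩
  simp only [f, Finset.sum_range]

theorem avoidSet_congr (g h : ℕ → G) (C : ℕ → ℕ) (i : ℕ) {x y : ℕ → G}
    (hxy : ∀ j < i, x j = y j) : avoidSet g h C i x = avoidSet g h C i y := by
  have : ∀ c : ℕ → ℤ, ∑ j ∈ Finset.range i, c j • x j = ∑ j ∈ Finset.range i, c j • y j :=
    fun c => Finset.sum_congr rfl fun j hj => by rw [hxy j (Finset.mem_range.1 hj)]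
  simp only [avoidSet, this]

/-- The sequence in which each term is computed from the previous ones by `F`. -/
def strongRecSeq (F : ℕ → (ℕ → G) → G) (i : ℕ) : G :=
  F i fun j => if _h : j < i then strongRecSeq F j else 0
termination_by i

theorem exists_sequence {K : AddSubgroup G}
    (hK : ∀ n : ℕ, 0 < n → ∃ y ∈ K, n • y ≠ 0) (g h : ℕ → G) (C : ℕ → ℕ)
    (χ : ℕ → AddChar G Circle) :
    ∃ x : ℕ → G, (∀ i, x i ∈ K) ∧
      (∀ i, ∀ c : ℤ, c ≠ 0 → |c| ≤ C i → c • x i ∉ avoidSet g h C i x) ∧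
      ∀ i, ∀ l < i, charDist (χ l) (x i) < (1 / 4) ^ i := by
  have hstep : ∀ (i : ℕ) (y : ℕ → G), ∃ z ∈ K,
      (∀ c : ℤ, c ≠ 0 → |c| ≤ C i → c • z ∉ avoidSet g h C i y) ∧
      ∀ l : Fin i, charDist (χ l) z < (1 / 4) ^ i := fun i y =>
    exists_zsmul_notMem hK (finite_avoidSet g h C i y) (C i) i (fun l => χ l) (by positivity)
  choose F hF hFa hFχ using hstep
  have hx : ∀ i, ∃ y, (∀ j < i, strongRecSeq F j = y j) ∧ strongRecSeq F i = F i y := by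
    intro i
    refine ⟨fun j => if _h : j < i then strongRecSeq F j else 0, fun j hj => ?_, ?_⟩
    · simp [hj]
    · rw [strongRecSeq]
  refine ⟨strongRecSeq F, fun i => ?_, fun i c hc hcC => ?_, fun i l hl => ?_⟩
  · obtain ⟨y, _, hy⟩ := hx i
    rw [hy]; exact hF i y
  · obtain ⟨y, hxy, hy⟩ := hx i
    rw [avoidSet_congr g h C i hxy, hy]; exact hFa i y c hc hcC
  · obtain ⟨y, _, hy⟩ := hx i
    rw [hy]; exact hFχ i y ⟨l, hl⟩

/-- The sum of the `n`-th dyadic block of a sequence. -/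
def blockSum (x : ℕ → G) (n : ℕ) : G := ∑ j ∈ Finset.Ico (2 ^ n) (2 ^ (n + 1)), x j

theorem charDist_blockSum_le {χ : AddChar G Circle} {x : ℕ → G} {n : ℕ} {r : ℝ} (hr : 0 ≤ r)
    (hr1 : r ≤ 1) (h : ∀ j, 2 ^ n ≤ j → charDist χ (x j) ≤ r ^ j) :
    charDist χ (blockSum x n) ≤ (2 ^ n : ℕ) * r ^ (2 ^ n) := by
  refine (charDist_sum_le _ _ _).trans ?_
  have : ∀ j ∈ Finset.Ico (2 ^ n) (2 ^ (n + 1)), charDist χ (x j) ≤ r ^ (2 ^ n) := by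
    intro j hj
    have hj' := (Finset.mem_Ico.1 hj).1
    exact (h j hj').trans (pow_le_pow_of_le_one hr hr1 hj')
  refine (Finset.sum_le_card_nsmul _ _ _ this).trans ?_
  rw [Nat.card_Ico, nsmul_eq_mul, show 2 ^ (n + 1) - 2 ^ n = 2 ^ n by rw [pow_succ]; omega]

/-- The tails of the family formed by the small multiples of the `x i` and by the elements
`blockSum x n + h n`. -/
def tailSet (x h : ℕ → G) (k : ℕ) : Set G :=
  {a | (∃ i, k ≤ i ∧ ∃ c : ℤ, |c| ≤ 2 ^ i ∧ a = c • x i) ∨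
    ∃ n, k ≤ n ∧ ∃ c : ℤ, |c| ≤ 1 ∧ a = c • (blockSum x n + h n)}

theorem isNullFamily_tailSet (x h : ℕ → G) : IsNullFamily (tailSet x h) where
  antitone := by
    rintro k l hkl a (⟨i, hi, ha⟩ | ⟨i, hi, ha⟩)
    · exact Or.inl ⟨i, hkl.trans hi, ha⟩
    · exact Or.inr ⟨i, hkl.trans hi, ha⟩
  zero_mem k := Or.inl ⟨k, le_rfl, 0, by simp, by simp⟩
  neg_mem k := by
    rintro a (⟨i, hi, c, hc, rfl⟩ | ⟨i, hi, c, hc, rfl⟩)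
    · exact Or.inl ⟨i, hi, -c, by simpa using hc, by simp⟩
    · exact Or.inr ⟨i, hi, -c, by simpa using hc, by rw [neg_smul]⟩
  finite_diff k := by
    have h1 : (⋃ i ∈ Iio k, (fun c : ℤ => c • x i) '' Icc (-2 ^ i) (2 ^ i)).Finite :=
      (finite_Iio k).biUnion fun i _ => (finite_Icc _ _).image _
    have h2 : (⋃ i ∈ Iio k, (fun c : ℤ => c • (blockSum x i + h i)) '' Icc (-1) 1).Finite :=
      (finite_Iio k).biUnion fun i _ => (finite_Icc _ _).image _
    refine (h1.union h2).subset ?_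
    rintro a ⟨⟨i, _, c, hc, rfl⟩ | ⟨i, _, c, hc, rfl⟩, hak⟩
    · refine Or.inl (mem_biUnion (x := i) ?_ ⟨c, abs_le.1 hc, rfl⟩)
      exact not_le.1 fun hki => hak (Or.inl ⟨i, hki, c, hc, rfl⟩)
    · refine Or.inr (mem_biUnion (x := i) ?_ ⟨c, abs_le.1 hc, rfl⟩)
      exact not_le.1 fun hki => hak (Or.inr ⟨i, hki, c, hc, rfl⟩)

theorem blockSum_mem {x : ℕ → G} {K : AddSubgroup G} (hx : ∀ i, x i ∈ K) (n : ℕ) :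
    blockSum x n ∈ K :=
  K.sum_mem fun j _ => hx j

theorem tailSet_subset {x h : ℕ → G} {K : AddSubgroup G} (hx : ∀ i, x i ∈ K) (hh : ∀ i, h i ∈ K)
    (k : ℕ) : tailSet x h k ⊆ K := by
  rintro a (⟨i, _, c, _, rfl⟩ | ⟨i, _, c, _, rfl⟩)
  · exact K.zsmul_mem (hx i) c
  · exact K.zsmul_mem (K.add_mem (blockSum_mem hx i) (hh i)) c

/-- The block of length `2 ^ n` contributes at most `2 ^ n * (2 / 3) ^ (2 ^ n)`, which tends to 0,
while `blockSum x n + h n` tends to 0 in the topology. -/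
theorem apply_eq_one_of_continuous {x h : ℕ → G} {χ : AddChar G Circle}
    (hχ : @Continuous G Circle (isNullFamily_tailSet x h).topology _ χ) {g : G}
    (hg : ∃ᶠ n in atTop, h n = g) : χ g = 1 := by
  rw [← charDist_eq_zero]
  refine le_antisymm (le_of_forall_pos_le_add fun ε hε => ?_) (charDist_nonneg χ g)
  obtain ⟨k, hk⟩ := (isNullFamily_tailSet x h).exists_charDist_lt hχ (half_pos one_pos)
  obtain ⟨l, hl⟩ := (isNullFamily_tailSet x h).exists_charDist_lt hχ (half_pos hε)
  have hx : ∀ i, k ≤ i → charDist χ (x i) ≤ (2 / 3) ^ i := fun i hi =>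
    charDist_le_pow fun j hj => (hk _ (Or.inl ⟨i, hi, 2 ^ j, by
      rw [abs_of_pos (by positivity)]; exact pow_le_pow_right₀ (by norm_num) hj, by
      rw [← natCast_zsmul]; push_cast; rfl⟩)).le
  have hlim : Tendsto (fun n : ℕ => ((2 ^ n : ℕ) : ℝ) * (2 / 3) ^ (2 ^ n)) atTop (𝓝 0) :=
    (tendsto_self_mul_const_pow_of_lt_one (by norm_num) (by norm_num)).comp
      (tendsto_pow_atTop_atTop_of_one_lt (by norm_num : 1 < 2))
  obtain ⟨n, rfl, hn, hkn, hln⟩ := (hg.and_eventually ((hlim.eventually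
    (gt_mem_nhds (half_pos hε))).and ((eventually_ge_atTop k).and (eventually_ge_atTop l)))).exists
  have h1 : charDist χ (blockSum x n) < ε / 2 :=
    (charDist_blockSum_le (by norm_num) (by norm_num) fun j hj =>
      hx j (hkn.trans (Nat.lt_two_pow_self.le.trans hj))).trans_lt hn
  have h2 : charDist χ (blockSum x n + h n) < ε / 2 :=
    hl _ (Or.inr ⟨n, hln, 1, by simp, by simp⟩)
  have h3 := charDist_add_le χ (blockSum x n + h n) (-blockSum x n)
  rw [charDist_neg, add_neg_cancel_comm] at h3
  linarith

/-- The rate `4 ^ (-i)` beats the multipliers `2 ^ i`, and also the block lengths. -/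
theorem continuous_of_charDist_lt {x h : ℕ → G} {χ : AddChar G Circle} {l : ℕ}
    (hx : ∀ i, l < i → charDist χ (x i) < (1 / 4) ^ i) (hh : ∀ n, χ (h n) = 1) :
    @Continuous G Circle (isNullFamily_tailSet x h).topology _ χ := by
  refine (isNullFamily_tailSet x h).continuous_addChar fun ε hε => ?_
  obtain ⟨N, hN⟩ := exists_pow_lt_of_lt_one hε (show (1 / 2 : ℝ) < 1 by norm_num)
  have hpow : ∀ i, N ≤ i → (2 : ℝ) ^ i * (1 / 4) ^ i ≤ ε := by
    intro i hi
    rw [← mul_pow, show (2 : ℝ) * (1 / 4) = 1 / 2 by norm_num]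
    exact (pow_le_pow_of_le_one (by norm_num) (by norm_num) hi).trans hN.le
  refine ⟨N + l + 1, ?_⟩
  rintro a (⟨i, hi, c, hc, rfl⟩ | ⟨n, hn, c, hc, rfl⟩)
  · refine (charDist_zsmul_le _ _ _).trans (le_trans ?_ (hpow i (by omega)))
    have hc' : |(c : ℝ)| ≤ 2 ^ i := by exact_mod_cast hc
    exact mul_le_mul hc' (hx i (by omega)).le (charDist_nonneg _ _) (by positivity)
  · have hc' : |(c : ℝ)| ≤ 1 := by exact_mod_cast hc
    have h2n : n < 2 ^ n := Nat.lt_two_pow_self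
    have h0 : charDist χ (h n) = 0 := charDist_eq_zero.2 (hh n)
    have h1 := charDist_blockSum_le (χ := χ) (x := x) (n := n) (r := 1 / 4) (by norm_num)
      (by norm_num) fun j hj => (hx j (by omega)).le
    have h2 : (2 ^ n : ℕ) * (1 / 4 : ℝ) ^ 2 ^ n ≤ 2 ^ n * (1 / 4) ^ n := by
      push_cast
      gcongr 2 ^ n * ?_
      exact pow_le_pow_of_le_one (by norm_num) (by norm_num) h2n.le
    have h3 := charDist_add_le χ (blockSum x n) (h n)
    have h4 := hpow n (by omega)
    refine (charDist_zsmul_le _ _ _).trans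
      ((mul_le_of_le_one_left (charDist_nonneg _ _) hc').trans ?_)
    linarith

end Construction

/-! ### The Protasov–Zelenyuk condition for the constructed family. -/

section Separation

variable {G : Type*} [AddCommGroup G]

/-- The linear map sending the `n`-th basis vector to the indicator of the `n`-th dyadic block. -/
noncomputable def blockCoeff : (ℕ →₀ ℤ) →ₗ[ℤ] (ℕ →₀ ℤ) :=
  Finsupp.linearCombination ℤ (blockSum fun j => Finsupp.single j (1 : ℤ))

theorem blockCoeff_apply (μ : ℕ →₀ ℤ) (j : ℕ) :
    blockCoeff μ j = if j = 0 then 0 else μ (Nat.log 2 j) := by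
  induction μ using Finsupp.induction_linear with
  | zero => simp
  | add μ ν h1 h2 =>
    rw [map_add, Finsupp.add_apply, h1, h2, Finsupp.add_apply]
    split_ifs <;> simp
  | single n a =>
    have h1 : blockCoeff (Finsupp.single n a) j =
        a * if j ∈ Finset.Ico (2 ^ n) (2 ^ (n + 1)) then 1 else 0 := by
      simp [blockCoeff, blockSum, Finsupp.single_apply]
    rw [h1]
    by_cases hj : j = 0
    · simp [hj]
    · have h2 : j ∈ Finset.Ico (2 ^ n) (2 ^ (n + 1)) ↔ n = Nat.log 2 j := by
        rw [Finset.mem_Ico, eq_comm, Nat.log_eq_iff (Or.inr ⟨by norm_num, hj⟩)]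
      simp [hj, h2, Finsupp.single_apply]

theorem linearCombination_blockCoeff (x : ℕ → G) (μ : ℕ →₀ ℤ) :
    Finsupp.linearCombination ℤ x (blockCoeff μ) =
      Finsupp.linearCombination ℤ (blockSum x) μ := by
  induction μ using Finsupp.induction_linear with
  | zero => simp
  | add μ ν h1 h2 => rw [map_add, map_add, h1, h2, map_add]
  | single n a => simp [blockCoeff, blockSum]

/-- Here `κ` collects the multiples of single terms and `μ` those of the block elements. The bound
on the support of `κ` prevents it from cancelling a long block. -/
theorem exists_coeff_of_mem_nsmul_tailSet {x h : ℕ → G} {m k : ℕ} {a : G}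
    (ha : a ∈ m • tailSet x h k) :
    ∃ κ μ : ℕ →₀ ℤ,
      a = Finsupp.linearCombination ℤ x (κ + blockCoeff μ) + Finsupp.linearCombination ℤ h μ ∧
      κ.support.card ≤ m ∧ (∀ i, |κ i| ≤ m * 2 ^ i) ∧ (∀ n, |μ n| ≤ m) ∧
      (∀ i < k, κ i = 0) ∧ ∀ n < k, μ n = 0 := by
  induction m generalizing a with
  | zero =>
    refine ⟨0, 0, ?_⟩
    simpa using ha
  | succ m ih =>
    rw [succ_nsmul] at ha
    obtain ⟨b, hb, d, hd, rfl⟩ := ha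
    obtain ⟨κ, μ, rfl, hcard, hκ, hμ, hκk, hμk⟩ := ih hb
    rcases hd with ⟨i, hi, c, hc, rfl⟩ | ⟨n, hn, c, hc, rfl⟩
    · refine ⟨κ + Finsupp.single i c, μ, ?_, ?_, fun j => ?_, fun n => ?_, fun j hj => ?_, hμk⟩
      · simp only [map_add, Finsupp.linearCombination_single]
        abel
      · refine (Finset.card_le_card Finsupp.support_add).trans
          ((Finset.card_union_le _ _).trans (add_le_add hcard ?_))
        exact (Finset.card_le_card Finsupp.support_single_subset).trans (by simp)
      · rw [Finsupp.add_apply]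
        refine (abs_add_le _ _).trans ?_
        push_cast
        rw [add_mul, one_mul]
        refine add_le_add (hκ j) ?_
        rw [Finsupp.single_apply]
        split_ifs with hij
        · rwa [← hij]
        · simp
      · push_cast
        linarith [hμ n]
      · rw [Finsupp.add_apply, hκk j hj, Finsupp.single_eq_of_ne (by omega), add_zero]
    · refine ⟨κ, μ + Finsupp.single n c, ?_, by omega, fun j => ?_, fun j => ?_, hκk,
        fun j hj => ?_⟩
      · simp only [map_add, Finsupp.linearCombination_single, linearCombination_blockCoeff,
          smul_add]
        abel
      · refine (hκ j).trans ?_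
        push_cast
        gcongr
        linarith
      · rw [Finsupp.add_apply]
        refine (abs_add_le _ _).trans ?_
        push_cast
        refine add_le_add (hμ j) ?_
        rw [Finsupp.single_apply]
        split_ifs
        · exact hc
        · simp
      · rw [Finsupp.add_apply, hμk j hj, Finsupp.single_eq_of_ne (by omega), add_zero]

theorem linearCombination_eq_sum_range (x : ℕ → G) (c : ℕ →₀ ℤ) {n : ℕ}
    (hn : ∀ j, c j ≠ 0 → j < n) :
    Finsupp.linearCombination ℤ x c = ∑ j ∈ Finset.range n, c j • x j := by
  rw [Finsupp.linearCombination_apply]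
  refine Finsupp.sum_of_support_subset _ (fun j hj => ?_) _ (by simp)
  exact Finset.mem_range.2 (hn j (Finsupp.mem_support_iff.1 hj))

/-- In a representation of `g l`, isolating the last `x i` with nonzero total coefficient puts a
multiple of `x i` in its avoided set. -/
theorem exists_notMem_nsmul_tailSet {g x h : ℕ → G}
    (hx : ∀ i, ∀ c : ℤ, c ≠ 0 → |c| ≤ (i * 2 ^ i + i : ℕ) →
      c • x i ∉ avoidSet g h (fun i => i * 2 ^ i + i) i x)
    {l : ℕ} (hl : g l ≠ 0) (m : ℕ) : ∃ k, g l ∉ m • tailSet x h k := by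
  -- All indices used exceed both `l` and `m`: `g l` is then among the elements considered at stage
  -- `i`, every block used is longer than `m`, and `m ≤ i` gives the coefficient bound `i * 2 ^ i +
  -- i`.
  refine ⟨l + m + 1, fun hmem => ?_⟩
  obtain ⟨κ, μ, hg, hcard, hκ, hμ, hκk, hμk⟩ := exists_coeff_of_mem_nsmul_tailSet hmem
  have hblock : ∀ n, μ n ≠ 0 → ∃ j, n ≤ j ∧ (κ + blockCoeff μ) j ≠ 0 := by
    intro n hn
    have hmn : m < n := by
      by_contra hmn
      exact hn (hμk n (by omega))
    have h2n : n < 2 ^ n := Nat.lt_two_pow_self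
    have hlt : κ.support.card < (Finset.Ico (2 ^ n) (2 ^ (n + 1))).card := by
      rw [Nat.card_Ico, show 2 ^ (n + 1) - 2 ^ n = 2 ^ n by rw [pow_succ]; omega]
      omega
    obtain ⟨j, hj, hjκ⟩ := Finset.exists_mem_notMem_of_card_lt_card hlt
    rw [Finset.mem_Ico] at hj
    have hj0 : j ≠ 0 := by omega
    refine ⟨j, by omega, ?_⟩
    rw [Finsupp.add_apply, Finsupp.notMem_support_iff.1 hjκ, blockCoeff_apply, if_neg hj0,
      (Nat.log_eq_iff (Or.inr ⟨by norm_num, hj0⟩)).2 hj, zero_add]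
    exact hn
  set c := κ + blockCoeff μ with hc
  have hcne : c.support.Nonempty := by
    rw [Finset.nonempty_iff_ne_empty, Ne, Finsupp.support_eq_empty]
    intro hc0
    have hμ0 : μ = 0 := by
      ext n
      by_contra hn
      obtain ⟨j, _, hj⟩ := hblock n hn
      exact hj (by rw [hc0]; rfl)
    exact hl (by rw [hg, hc0, hμ0]; simp)
  set i := c.support.max' hcne with hi
  have hci : c i ≠ 0 := Finsupp.mem_support_iff.1 (c.support.max'_mem hcne)
  have hmax : ∀ j, c j ≠ 0 → j ≤ i := fun j hj =>
    c.support.le_max' j (Finsupp.mem_support_iff.2 hj)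
  have hki : l + m + 1 ≤ i := by
    by_contra hlt
    apply hci
    rw [hc, Finsupp.add_apply, hκk i (by omega), blockCoeff_apply, zero_add]
    split_ifs with h0
    · rfl
    · exact hμk _ ((Nat.log_le_self 2 i).trans_lt (by omega))
  have hmi : (m : ℤ) ≤ i := by omega
  have hbound : ∀ j, |c j| ≤ (i * 2 ^ i + i : ℕ) := by
    intro j
    by_cases hj : c j = 0
    · rw [hj, abs_zero]; positivity
    · have hji := hmax j hj
      rw [hc, Finsupp.add_apply]
      refine (abs_add_le _ _).trans ?_
      push_cast
      refine add_le_add ((hκ j).trans ?_) ?_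
      · gcongr
        norm_num
      · rw [blockCoeff_apply]
        split_ifs
        · simp
        · exact (hμ _).trans hmi
  refine hx i (c i) hci (hbound i) ⟨l, by omega, c, μ, hbound, fun j => (hμ j).trans ?_, ?_⟩
  · push_cast
    nlinarith [show (0 : ℤ) ≤ i * 2 ^ i by positivity]
  · rw [hg, linearCombination_eq_sum_range x c (n := i + 1) fun j hj => by
        have := hmax j hj; omega,
      linearCombination_eq_sum_range h μ (n := i + 1) fun n hn => by
        obtain ⟨j, hnj, hj⟩ := hblock n hn
        have := hmax j hj
        omega,
      Finset.sum_range_succ (fun j => c j • x j)]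
    abel

end Separation

/-! ### Assembly of the topology and computation of its radical. -/

section Main

variable {G : Type*} [AddCommGroup G]

/-- Every countable subgroup of an unbounded Abelian group is the von Neumann radical of a complete
non-discrete Hausdorff group topology. -/
theorem mem_NRC_of_countable (hG : IsUnboundedAddGroup G) (H : AddSubgroup G) [Countable H] :
    H ∈ NRC G := by
  obtain ⟨K, hHK, hKc, hK⟩ := exists_countable_unbounded_addSubgroup hG H
  obtain ⟨g, hg⟩ := exists_surjective_nat K
  obtain ⟨e, he⟩ := exists_surjective_nat H
  let h : ℕ → G := fun n => e n.unpair.1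
  have hhH : ∀ n, h n ∈ H := fun n => (e _).2
  have hfreq : ∀ y ∈ H, ∃ᶠ n in atTop, h n = y := by
    intro y hy
    obtain ⟨p, hp⟩ := he ⟨y, hy⟩
    rw [frequently_atTop]
    exact fun N => ⟨Nat.pair p N, Nat.right_le_pair p N, by simp [h, hp]⟩
  have hχ : ∀ l, ∃ χ : AddChar G Circle, (∀ y ∈ H, χ y = 1) ∧ ((g l : G) ∉ H → χ (g l) ≠ 1) := by
    intro l
    by_cases hl : (g l : G) ∈ H
    · exact ⟨1, fun _ _ => rfl, fun h => absurd hl h⟩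
    · obtain ⟨χ, h1, h2⟩ := exists_addChar_apply_ne_one H hl
      exact ⟨χ, h1, fun _ => h2⟩
  choose χ hχH hχg using hχ
  obtain ⟨x, hxK, hx, hxχ⟩ := exists_sequence hK (fun l => (g l : G)) h
    (fun i => i * 2 ^ i + i) χ
  have hA := isNullFamily_tailSet x h
  have hAK : ∀ k, tailSet x h k ⊆ K := tailSet_subset hxK fun n => hHK (hhH n)
  refine ⟨hA.topology, hA.isTopologicalAddGroup, ?_, ?_, hA.completeSpace, ?_⟩
  · refine hA.t2Space fun y hy m => ?_
    by_cases hyK : y ∈ K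
    · obtain ⟨l, hl⟩ := hg ⟨y, hyK⟩
      have hly : (g l : G) = y := by rw [hl]
      have := exists_notMem_nsmul_tailSet (g := fun l => (g l : G)) hx (l := l)
        (by simpa only [hly] using hy) m
      simpa only [hly] using this
    · refine ⟨0, fun hmem => hyK ?_⟩
      obtain ⟨κ, μ, rfl, -⟩ := exists_coeff_of_mem_nsmul_tailSet hmem
      refine K.add_mem ?_ ?_ <;> rw [Finsupp.linearCombination_apply]
      · exact K.sum_mem fun j _ => K.zsmul_mem (hxK j) _
      · exact K.sum_mem fun j _ => K.zsmul_mem (hHK (hhH j)) _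
  -- Discreteness would make late `x i` vanish, but the avoided set contains 0 as soon as `i`
  -- reaches an index `l` with `g l = 0`.
  · intro hdisc
    have h0 : ({0} : Set G) ∈ @nhds G hA.topology 0 :=
      let _ := hA.topology
      (isOpen_discrete _).mem_nhds rfl
    obtain ⟨k, hk⟩ := hA.exists_subset_of_mem_nhds h0
    obtain ⟨l, hl⟩ := hg 0
    have hx0 : x (k + l + 1) = 0 := hk (Or.inl ⟨k + l + 1, by omega, 1, by
      rw [abs_one]; exact one_le_pow₀ (by norm_num), by simp⟩)
    refine hx (k + l + 1) 1 one_ne_zero (by rw [abs_one]; exact_mod_cast (by omega : 1 ≤ (k + l + 1) * 2 ^ (k + l + 1) + (k + l + 1))) ?_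
    exact ⟨l, by omega, 0, 0, by simp; positivity, by simp; positivity, by simp [hl, hx0]⟩
  · let _ := hA.topology
    ext y
    rw [mem_vonNeumannRadical]
    refine ⟨fun hy => ?_, fun hy ψ hψ => apply_eq_one_of_continuous hψ (hfreq y hy)⟩
    -- The whole family lies in `K`, so every character trivial on `K` is continuous.
    have hyK : y ∈ K := by
      by_contra hyK
      obtain ⟨ψ, hψK, hψy⟩ := exists_addChar_apply_ne_one K hyK
      refine hψy (hy ψ (hA.continuous_addChar fun ε hε => ⟨0, fun a ha => ?_⟩))
      rw [charDist_eq_zero.2 (hψK a (hAK 0 ha))]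
      exact hε.le
    obtain ⟨l, hl⟩ := hg ⟨y, hyK⟩
    have hly : (g l : G) = y := by rw [hl]
    by_contra hyH
    refine hχg l (by rwa [hly]) ?_
    rw [hly]
    exact hy (χ l) (continuous_of_charDist_lt (fun i hi => hxχ i l hi) fun n => hχH l _ (hhH n))

end Main

theorem theorem1 {G : Type*} [AddCommGroup G] (hG : IsUnboundedAddGroup G)
    (H : AddSubgroup G) (hcount : Countable H) (htors : IsAddTorsion H) :
    H ∈ NRC G := by
  exact mem_NRC_of_countable hG H
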